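/- **Lemma 3.1** (label `bound`). *Setting.* Let $(\Omega,\Im,P)$ be a probability space and $\mathcal H\subset\mathcal F\subset\Im$ sigma-algebras containing the $P$-null sets. Let $Y$ be an $\mathcal F$-measurable random variable in $\mathbb R^d$, and let $\Xi$ be the set of $\mathcal H$-measurable $\mathbb R^d$-valued random variables; $\xi Y$ is the scalar product and $|\cdot|$ the Euclidean norm. Write $V^+=\max(V,0)$, $V^-=\max(-V,0)$. For a real random variable $Z$, $E(Z|\mathcal H):=E(Z^+|\mathcal H)-E(Z^-|\mathcal H)$, where conditional expectations of non-negative variables are $[0,\infty]$-valued. Assume: 1. $D\in\mathcal B(\mathbb R^d)\otimes\mathcal H$ is a random set such that for almost all $\omega$, $D(\omega)$ is a (non-empty) vector subspace of $\mathbb R^d$ and is the smallest affine subspace containing the support of the regular conditional distribution $P(Y\in\cdot\,|\mathcal H)(\omega)$. 2. $\alpha,\beta>0$ are $\mathcal H$-measurable random variables such that for all $\xi\in\Xi$ with $\xi\in D$ a.s., $P(\xi Y\le-\alpha|\xi|\,|\mathcal H)\ge\beta$ a.s. 3. $V:\Omega\times\mathbb R\to\mathbb R$; for almost all $\omega$,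 $V(\omega,\cdot)$ is nondecreasing and continuous; $V(\cdot,x)$ is $\mathcal F$-measurable for each $x$. 4. For all $x,y\in\mathbb R$, $E(V^-(x-|y||Y|)\,|\mathcal H)<\infty$ and $E(V^+(x+|y||Y|)\,|\mathcal H)<\infty$ a.s. 5. There are constants $C>0$ and $\underline\gamma>\overline\gamma>0$ such that, almost surely, for all $x\in\mathbb R$ and $\lambda\ge1$, $V(\lambda x)\le\lambda^{\overline\gamma}V(x)+C\lambda^{\overline\gamma}$ and $V(\lambda x)\le\lambda^{\underline\gamma}V(x)+C\lambda^{\underline\gamma}$. 6. There is a non-negative $\mathcal H$-measurable random variable $N$ with $P\left(V(-N)<-\frac{2C}{\beta}-1\,\middle|\,\mathcal H\right)\ge1-\beta/2$ a.s. For an $\mathcal H$-measurable real random variable $X$ (in particular for a constant $X=x\in\mathbb R$) put $$v(X):=\operatorname{ess.sup}_{\xi\in\Xi}E(V(X+\xi Y)\,|\mathcal H).$$ *Conclusions.* (a) For all real $x_0<x_1$ there is an $\mathcal H$-measurable random variable $K=K(\omega,x_0,x_1)>0$ such that for every $x\in[x_0,x_1]$, almost surely, $$v(x)=\operatorname{ess.sup}_{\xi\in\Xi,\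 |\xi|\le K}E(V(x+\xi Y)\,|\mathcal H).$$ (b) For every $x\in\mathbb R$, $-\infty<v(x)<+\infty$ a.s. (c) For every $\mathcal H$-measurable random variable $I>0$ there is an $\mathcal H$-measurable random variable $N'>0$ such that $v(-N')\le-I$ a.s. Moreover, for the same $N'$ and every function $w:\Omega\times\mathbb R\to[-\infty,\infty]$ such that $w(\cdot,x)=v(x)$ a.s. for each $x\in\mathbb R$ and $w(\omega,\cdot)$ is nondecreasing for almost all $\omega$, one has $w(\omega,-N'(\omega))\le-I(\omega)$ for almost all $\omega$. -/

import Mathlib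

open MeasureTheory ProbabilityTheory
open scoped ENNReal

noncomputable section

namespace OneStep

/-- The generalized conditional expectation `E(Z|ℋ) = E(Z⁺|ℋ) - E(Z⁻|ℋ)`, with values in
`[-∞, ∞]`. The conditional expectations of the non-negative variables `Z⁺`, `Z⁻` are always
defined, with values in `[0, ∞]`. (Where both are infinite the difference is meaningless.) -/
def genCondExp {Ω : Type*} (ℋ : MeasurableSpace Ω) {m0 : MeasurableSpace Ω} (P : Measure Ω)
    (Z : Ω → ℝ) : Ω → EReal :=
  fun ω => ((condLExp ℋ P (fun ω' => ENNReal.ofReal (Z ω')) ω : ℝ≥0∞) : EReal)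
    - ((condLExp ℋ P (fun ω' => ENNReal.ofReal (-Z ω')) ω : ℝ≥0∞) : EReal)

/-- `f` is (a version of) the essential supremum of the family `S` of random variables: the
almost surely smallest random variable that dominates every member of `S` almost surely. -/
def IsEssSup {Ω : Type*} {m0 : MeasurableSpace Ω} (P : Measure Ω) (S : Set (Ω → EReal))
    (f : Ω → EReal) : Prop :=
  Measurable f ∧ (∀ X ∈ S, X ≤ᵐ[P] f) ∧
    ∀ g : Ω → EReal, Measurable g → (∀ X ∈ S, X ≤ᵐ[P] g) → f ≤ᵐ[P] g

/-- Every family of functions has an essential supremum with respect to a finite measure. -/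
theorem exists_isEssSup {Ω : Type*} {_m0 : MeasurableSpace Ω} (P : Measure Ω) [IsFiniteMeasure P]
    (S : Set (Ω → EReal)) : ∃ f, IsEssSup P S f := by
  classical
  let φ : EReal → ℝ≥0∞ := fun z => (1 + EReal.exp z)⁻¹
  have hφm : Measurable φ := (measurable_const.add EReal.measurable_exp).inv
  have hφa : ∀ a b, a ≤ b → φ b ≤ φ a := fun a b h =>
    ENNReal.inv_le_inv.2 (add_le_add_right (EReal.exp_monotone h) 1)
  have hφs : ∀ a b, φ b ≤ φ a → a ≤ b := fun a b h =>
    EReal.exp_le_exp_iff.1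
      ((ENNReal.add_le_add_iff_left ENNReal.one_ne_top).1 (ENNReal.inv_le_inv.1 h))
  have hφ1 : ∀ a, φ a ≤ 1 := fun a => ENNReal.inv_le_one.2 le_self_add
  let B : Set (Ω → EReal) := {g | Measurable g ∧ ∀ X ∈ S, X ≤ᵐ[P] g}
  have hB : B.Nonempty := ⟨fun _ => ⊤, measurable_const, fun X _ =>
    Filter.Eventually.of_forall fun _ => le_top⟩
  let J : Set ℝ≥0∞ := (fun g : Ω → EReal => ∫⁻ ω, φ (g ω) ∂P) '' B
  obtain ⟨u, -, hu, huJ⟩ := exists_seq_tendsto_sSup (S := J) (hB.image _) (OrderTop.bddAbove J)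
  choose g hgB hgu using huJ
  let f : Ω → EReal := fun ω => ⨅ n, g n ω
  have hf : Measurable f := Measurable.iInf fun n => (hgB n).1
  have hfS : ∀ X ∈ S, X ≤ᵐ[P] f := by
    intro X hX
    filter_upwards [ae_all_iff.2 fun n => (hgB n).2 X hX] with ω hω
    exact le_iInf hω
  have hsup : sSup J ≤ ∫⁻ ω, φ (f ω) ∂P := by
    refine le_of_tendsto' hu fun n => ?_
    rw [← hgu n]
    exact lintegral_mono fun ω => hφa _ _ (iInf_le _ n)
  refine ⟨f, hf, hfS, fun h hh hhS => ?_⟩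
  have hmin : (fun ω => min (f ω) (h ω)) ∈ B := by
    refine ⟨hf.min hh, fun X hX => ?_⟩
    filter_upwards [hfS X hX, hhS X hX] with ω h1 h2
    exact le_min h1 h2
  have hle : ∫⁻ ω, φ (min (f ω) (h ω)) ∂P ≤ ∫⁻ ω, φ (f ω) ∂P :=
    (le_sSup (Set.mem_image_of_mem _ hmin)).trans hsup
  have hfin : ∫⁻ ω, φ (f ω) ∂P ≠ ⊤ := by
    refine ((lintegral_mono fun ω => hφ1 (f ω)).trans_lt ?_).ne
    simp
  have hae := ae_eq_of_ae_le_of_lintegral_le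
    (Filter.Eventually.of_forall fun ω => hφa _ _ (min_le_left (f ω) (h ω))) hfin
    (hφm.comp (hf.min hh)).aemeasurable hle
  filter_upwards [hae] with ω hω
  exact (hφs _ _ hω.ge).trans (min_le_right _ _)

/-- The essential supremum of a family of random variables (unique up to almost sure equality). -/
def essSupFamily {Ω : Type*} {m0 : MeasurableSpace Ω} (P : Measure Ω) [IsFiniteMeasure P]
    (S : Set (Ω → EReal)) : Ω → EReal :=
  (exists_isEssSup P S).choose

theorem essSupFamily_spec {Ω : Type*} {m0 : MeasurableSpace Ω} (P : Measure Ω)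
    [IsFiniteMeasure P] (S : Set (Ω → EReal)) : IsEssSup P S (essSupFamily P S) :=
  (exists_isEssSup P S).choose_spec

/-- The expected-utility variable `E(V(X + ξY)|ℋ)` of the strategy `ξ` from capital `X`. -/
def condUtility {Ω : Type*} (ℋ : MeasurableSpace Ω) {m0 : MeasurableSpace Ω} (P : Measure Ω)
    {d : ℕ} (V : Ω → ℝ → ℝ) (Y : Ω → EuclideanSpace ℝ (Fin d)) (X : Ω → ℝ)
    (ξ : Ω → EuclideanSpace ℝ (Fin d)) : Ω → EReal :=
  genCondExp ℋ P (fun ω => V ω (X ω + inner ℝ (ξ ω) (Y ω)))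

/-- The value `v(X) = ess sup_ξ E(V(X + ξY)|ℋ)`, over all `ℋ`-measurable `ξ`, at a (possibly
random) initial capital `X`. -/
def value {Ω : Type*} (ℋ : MeasurableSpace Ω) {m0 : MeasurableSpace Ω} (P : Measure Ω)
    [IsFiniteMeasure P] {d : ℕ} (V : Ω → ℝ → ℝ) (Y : Ω → EuclideanSpace ℝ (Fin d))
    (X : Ω → ℝ) : Ω → EReal :=
  essSupFamily P {Z | ∃ ξ : Ω → EuclideanSpace ℝ (Fin d), Measurable[ℋ] ξ ∧
    Z = condUtility ℋ P V Y X ξ}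

/-- The same essential supremum, over the `ℋ`-measurable `ξ` with `|ξ| ≤ K` almost surely. -/
def valueBounded {Ω : Type*} (ℋ : MeasurableSpace Ω) {m0 : MeasurableSpace Ω} (P : Measure Ω)
    [IsFiniteMeasure P] {d : ℕ} (V : Ω → ℝ → ℝ) (Y : Ω → EuclideanSpace ℝ (Fin d))
    (K : Ω → ℝ) (X : Ω → ℝ) : Ω → EReal :=
  essSupFamily P {Z | ∃ ξ : Ω → EuclideanSpace ℝ (Fin d), Measurable[ℋ] ξ ∧
    (∀ᵐ ω ∂P, ‖ξ ω‖ ≤ K ω) ∧ Z = condUtility ℋ P V Y X ξ}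

/-- The regular conditional distribution `P(Y ∈ · | ℋ)`: the conditional distribution of `Y`
given the identity map from `Ω` to `(Ω, ℋ)`. -/
def regCondDistrib {Ω : Type*} (ℋ : MeasurableSpace Ω) {m0 : MeasurableSpace Ω} (P : Measure Ω)
    [IsFiniteMeasure P] {d : ℕ} (Y : Ω → EuclideanSpace ℝ (Fin d)) :
    @Kernel Ω (EuclideanSpace ℝ (Fin d)) ℋ _ :=
  @condDistrib Ω Ω (EuclideanSpace ℝ (Fin d)) _ _ _ m0 ℋ Y id P _

/-- `D` is a product-measurable random set, and almost surely `D ω` is a linear subspace which is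
the smallest affine subspace containing the support of `P(Y ∈ · | ℋ)(ω)`. -/
def IsSupportSubspace {Ω : Type*} (ℋ : MeasurableSpace Ω) {m0 : MeasurableSpace Ω}
    (P : Measure Ω) [IsFiniteMeasure P] {d : ℕ} (Y : Ω → EuclideanSpace ℝ (Fin d))
    (D : Ω → Set (EuclideanSpace ℝ (Fin d))) : Prop :=
  MeasurableSet[ℋ.prod inferInstance]
      {p : Ω × EuclideanSpace ℝ (Fin d) | p.2 ∈ D p.1} ∧
    ∀ᵐ ω ∂P, (∃ W : Submodule ℝ (EuclideanSpace ℝ (Fin d)),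
        D ω = (W : Set (EuclideanSpace ℝ (Fin d)))) ∧
      D ω = (affineSpan ℝ (regCondDistrib ℋ P Y ω).support :
        Set (EuclideanSpace ℝ (Fin d)))

end OneStep

end

/-! Two facts about a strategy `ξ` drive the proof. Since `X + ξY ≤ max(1, |ξ|) (M + |Y|)` for
capital `X ≤ M`, the first growth condition bounds its expected gain by a multiple of
`max(1, |ξ|) ^ γ₁`. On the other hand, with conditional probability at least `β / 2` the strategy
loses `α|ξ|` while `V(-N) ≤ -C - 1`, so by the second growth condition its expected loss is at least
a multiple of `(α|ξ| - X) ^ γ₂`. As `γ₁ < γ₂`, strategies above an `ℋ`-measurable size are worse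
than not investing at all, and from a large enough debt every strategy is as bad as desired.

The loss estimate is only available for strategies in the span of the support of the conditional
distribution of `Y`. Projecting `ξ` onto this span does not change `ξY`, and the projection is
`ℋ`-measurable: by the mean ergodic theorem, the projection onto the orthogonal complement is the
limit of the Birkhoff averages of a contraction that depends measurably on the conditional
distribution. -/

namespace OneStep

section ConditionalExpectation

variable {Ω : Type*} {ℋ m0 : MeasurableSpace Ω} {P : Measure Ω}

theorem lintegral_mul_condLExp (hH : ℋ ≤ m0) [SigmaFinite (P.trim hH)] {b f : Ω → ℝ≥0∞}
    (hb : Measurable[ℋ] b) (hf : AEMeasurable f P) :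
    ∫⁻ ω, b ω * P⁻[f|ℋ] ω ∂P = ∫⁻ ω, b ω * f ω ∂P := by
  have hb' : AEMeasurable b P := (hb.mono hH le_rfl).aemeasurable
  have htrim : (P.withDensity P⁻[f|ℋ]).trim hH = (P.withDensity f).trim hH := by
    refine @Measure.ext _ ℋ _ _ fun s hs => ?_
    rw [trim_measurableSet_eq hH hs, trim_measurableSet_eq hH hs,
      withDensity_apply _ (hH s hs), withDensity_apply _ (hH s hs),
      setLIntegral_condLExp hH P f hs]
  calc ∫⁻ ω, b ω * P⁻[f|ℋ] ω ∂P
      = ∫⁻ ω, b ω ∂(P.withDensity P⁻[f|ℋ]) := by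
        simp only [lintegral_withDensity_eq_lintegral_mul₀
          (measurable_condLExp' ℋ P f).aemeasurable hb', Pi.mul_apply, mul_comm]
    _ = ∫⁻ ω, b ω ∂(P.withDensity f) := by
        rw [← lintegral_trim hH hb, htrim, lintegral_trim hH hb]
    _ = ∫⁻ ω, b ω * f ω ∂P := by
        simp only [lintegral_withDensity_eq_lintegral_mul₀ hf hb', Pi.mul_apply, mul_comm]

theorem condLExp_mul_left (hH : ℋ ≤ m0) [SigmaFinite (P.trim hH)] {c f : Ω → ℝ≥0∞}
    (hc : Measurable[ℋ] c) (hf : AEMeasurable f P) :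
    P⁻[fun ω => c ω * f ω|ℋ] =ᵐ[P] fun ω => c ω * P⁻[f|ℋ] ω := by
  refine (ae_eq_condLExp hH P _ (hc.mul (measurable_condLExp _ _ _)) fun s hs => ?_).symm
  have h := lintegral_mul_condLExp hH (hc.indicator hs) hf
  simp only [← Set.indicator_mul_left] at h
  rwa [lintegral_indicator (hH s hs), lintegral_indicator (hH s hs)] at h

theorem condLExp_indicator (hH : ℋ ≤ m0) [SigmaFinite (P.trim hH)] {s : Set Ω}
    (hs : MeasurableSet[ℋ] s) (f : Ω → ℝ≥0∞) :
    P⁻[s.indicator f|ℋ] =ᵐ[P] s.indicator P⁻[f|ℋ] := by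
  refine (ae_eq_condLExp hH P _ ((measurable_condLExp _ _ _).indicator hs) fun t ht => ?_).symm
  rw [setLIntegral_indicator (hH s hs), setLIntegral_indicator (hH s hs),
    setLIntegral_condLExp hH P f (hs.inter ht)]

theorem condLExp_mono_on (hH : ℋ ≤ m0) [SigmaFinite (P.trim hH)] {s : Set Ω}
    (hs : MeasurableSet[ℋ] s) {f g : Ω → ℝ≥0∞} (h : ∀ᵐ ω ∂P, ω ∈ s → f ω ≤ g ω) :
    ∀ᵐ ω ∂P, ω ∈ s → P⁻[f|ℋ] ω ≤ P⁻[g|ℋ] ω := by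
  have hle : s.indicator f ≤ᵐ[P] s.indicator g := by
    filter_upwards [h] with ω hω
    exact Set.indicator_le_indicator' hω
  filter_upwards [condLExp_indicator hH hs f, condLExp_indicator hH hs g,
    condLExp_mono (mΩ := ℋ) hle] with ω hf hg hfg hω
  rwa [hf, hg, Set.indicator_of_mem hω, Set.indicator_of_mem hω] at hfg

theorem condLExp_congr_on (hH : ℋ ≤ m0) [SigmaFinite (P.trim hH)] {s : Set Ω}
    (hs : MeasurableSet[ℋ] s) {f g : Ω → ℝ≥0∞} (h : ∀ᵐ ω ∂P, ω ∈ s → f ω = g ω) :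
    ∀ᵐ ω ∂P, ω ∈ s → P⁻[f|ℋ] ω = P⁻[g|ℋ] ω := by
  filter_upwards [condLExp_mono_on hH hs (h.mono fun _ h hω => (h hω).le),
    condLExp_mono_on hH hs (h.mono fun _ h hω => (h hω).ge)] with ω hle hge hω
  exact (hle hω).antisymm (hge hω)

theorem condLExp_indicator_one [IsFiniteMeasure P] {s : Set Ω}
    (hs : NullMeasurableSet s P) :
    P⁻[s.indicator fun _ => 1|ℋ] =ᵐ[P]
      fun ω => ENNReal.ofReal (P[s.indicator fun _ => (1 : ℝ)|ℋ] ω) := by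
  have hofReal : (fun ω => ENNReal.ofReal (s.indicator (fun _ => (1 : ℝ)) ω)) =
      s.indicator fun _ => 1 :=
    (Set.indicator_comp_of_zero ENNReal.ofReal_zero).symm.trans <| by
      simp only [Function.comp_def, ENNReal.ofReal_one]
  rw [← hofReal]
  exact condLExp_ofReal ℋ ((integrable_const 1).indicator₀ hs)
    (.of_forall (Set.indicator_nonneg fun _ _ => zero_le_one))

theorem condExp_indicator_one_le_one (hH : ℋ ≤ m0) [IsFiniteMeasure P] {s : Set Ω}
    (hs : NullMeasurableSet s P) : ∀ᵐ ω ∂P, P[s.indicator fun _ => (1 : ℝ)|ℋ] ω ≤ 1 := by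
  have hle := condExp_mono (m := ℋ) ((integrable_const (1 : ℝ)).indicator₀ hs)
    (integrable_const (1 : ℝ)) (.of_forall (Set.indicator_le_self' fun _ _ => zero_le_one))
  rwa [condExp_const hH] at hle

theorem condExp_indicator_add_le_one_add_inter (hH : ℋ ≤ m0) [IsFiniteMeasure P] {s t : Set Ω}
    (hs : NullMeasurableSet s P) (ht : NullMeasurableSet t P) :
    ∀ᵐ ω ∂P, P[s.indicator fun _ => (1 : ℝ)|ℋ] ω + P[t.indicator fun _ => (1 : ℝ)|ℋ] ω ≤
      1 + P[(s ∩ t).indicator fun _ => (1 : ℝ)|ℋ] ω := by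
  have hint {u : Set Ω} (hu : NullMeasurableSet u P) :
      Integrable (u.indicator fun _ => (1 : ℝ)) P := (integrable_const 1).indicator₀ hu
  have hle : (s.indicator fun _ => (1 : ℝ)) + t.indicator (fun _ => 1) ≤ᵐ[P]
      (fun _ => 1) + (s ∩ t).indicator fun _ => 1 := by
    refine .of_forall fun ω => ?_
    by_cases hs : ω ∈ s <;> by_cases ht : ω ∈ t <;> simp [hs, ht]
  filter_upwards [condExp_mono (m := ℋ) ((hint hs).add (hint ht))
      ((integrable_const 1).add (hint (hs.inter ht))) hle,
    condExp_add (hint hs) (hint ht) ℋ,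
    condExp_add (integrable_const 1) (hint (hs.inter ht)) ℋ] with ω hle hst hinter
  rwa [hst, hinter, condExp_const hH] at hle

theorem genCondExp_congr_on (hH : ℋ ≤ m0) [SigmaFinite (P.trim hH)] {s : Set Ω}
    (hs : MeasurableSet[ℋ] s) {Z Z' : Ω → ℝ} (h : ∀ᵐ ω ∂P, ω ∈ s → Z ω = Z' ω) :
    ∀ᵐ ω ∂P, ω ∈ s → genCondExp ℋ P Z ω = genCondExp ℋ P Z' ω := by
  have hcongr (φ : ℝ → ℝ≥0∞) :=
    condLExp_congr_on hH hs (h.mono fun _ h hω => congrArg φ (h hω))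
  filter_upwards [hcongr ENNReal.ofReal, hcongr fun z => ENNReal.ofReal (-z)] with ω hpos hneg hω
  simp only [genCondExp, hpos hω, hneg hω]

theorem genCondExp_congr_ae {Z Z' : Ω → ℝ} (h : Z =ᵐ[P] Z') :
    genCondExp ℋ P Z =ᵐ[P] genCondExp ℋ P Z' := by
  filter_upwards [condLExp_congr_ae (mΩ := ℋ) (h.fun_comp ENNReal.ofReal),
    condLExp_congr_ae (mΩ := ℋ) (h.fun_comp fun z => ENNReal.ofReal (-z))] with ω hpos hneg
  simp only [Function.comp_def] at hpos hneg
  simp only [genCondExp, hpos, hneg]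

theorem genCondExp_le_sub {Z : Ω → ℝ} {ω : Ω} {a b : ℝ} (ha : 0 ≤ a) (hb : 0 ≤ b)
    (hpos : P⁻[fun ω => ENNReal.ofReal (Z ω) | ℋ] ω ≤ ENNReal.ofReal a)
    (hneg : ENNReal.ofReal b ≤ P⁻[fun ω => ENNReal.ofReal (-Z ω) | ℋ] ω) :
    genCondExp ℋ P Z ω ≤ ((a - b : ℝ) : EReal) := by
  rw [genCondExp, EReal.coe_sub]
  refine EReal.sub_le_sub ?_ ?_
  · simpa [EReal.coe_ennreal_ofReal, ha] using EReal.coe_ennreal_le_coe_ennreal_iff.2 hpos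
  · simpa [EReal.coe_ennreal_ofReal, hb] using EReal.coe_ennreal_le_coe_ennreal_iff.2 hneg

theorem neg_toReal_le_genCondExp {Z : Ω → ℝ} {ω : Ω}
    (h : P⁻[fun ω => ENNReal.ofReal (-Z ω) | ℋ] ω ≠ ∞) :
    ((-(P⁻[fun ω => ENNReal.ofReal (-Z ω) | ℋ] ω).toReal : ℝ) : EReal) ≤ genCondExp ℋ P Z ω := by
  rw [genCondExp, EReal.coe_neg, EReal.coe_ennreal_toReal h, ← zero_sub]
  exact EReal.sub_le_sub (EReal.coe_ennreal_nonneg _) le_rfl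

end ConditionalExpectation

section Projection

variable {E : Type*} [NormedAddCommGroup E] [InnerProductSpace ℝ E]

theorem mem_orthogonal_span_iff {s : Set E} {v : E} :
    v ∈ (Submodule.span ℝ s)ᗮ ↔ ∀ y ∈ s, inner ℝ y v = 0 := by
  rw [← Submodule.span_singleton_le_iff_mem, ← Submodule.isOrtho_iff_le, Submodule.isOrtho_comm,
    Submodule.isOrtho_span]
  simp only [Set.mem_singleton_iff, forall_eq]

/-- The operator `v ↦ v - ⟪y, v⟫ y / (1 + |y|²)`, a damped orthogonal projection onto the
hyperplane `yᗮ`. The damping makes it continuous in `y`, also at `0`. -/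
noncomputable def dampedProjection (y : E) : E →L[ℝ] E :=
  1 - (1 + ‖y‖ ^ 2)⁻¹ • InnerProductSpace.rankOne ℝ y y

theorem dampedProjection_apply (y v : E) :
    dampedProjection y v = v - ((1 + ‖y‖ ^ 2)⁻¹ * inner ℝ y v) • y := by
  simp [dampedProjection, mul_smul]

theorem continuous_dampedProjection : Continuous (dampedProjection (E := E)) := by
  have hrank : Continuous fun y : E => InnerProductSpace.rankOne ℝ y y :=
    (InnerProductSpace.rankOne ℝ).continuous.clm_apply continuous_id
  have hdamp (y : E) : 1 + ‖y‖ ^ 2 ≠ 0 := by positivity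
  exact continuous_const.sub (.smul (.inv₀ (by fun_prop) hdamp) hrank)

theorem inner_dampedProjection_self (y v : E) :
    inner ℝ v (dampedProjection y v) = ‖v‖ ^ 2 - (1 + ‖y‖ ^ 2)⁻¹ * inner ℝ y v ^ 2 := by
  rw [dampedProjection_apply, inner_sub_right, inner_smul_right, real_inner_self_eq_norm_sq,
    real_inner_comm y v]
  ring

theorem norm_dampedProjection_le_one (y : E) : ‖dampedProjection y‖ ≤ 1 := by
  refine ContinuousLinearMap.opNorm_le_bound _ zero_le_one fun v => ?_
  have hsq : ‖dampedProjection y v‖ ^ 2 =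
      ‖v‖ ^ 2 - (2 + ‖y‖ ^ 2) * ((1 + ‖y‖ ^ 2)⁻¹ * inner ℝ y v) ^ 2 := by
    rw [dampedProjection_apply, norm_sub_sq_real, norm_smul, inner_smul_right,
      real_inner_comm, mul_pow, Real.norm_eq_abs, sq_abs]
    field_simp
    ring
  rw [one_mul, ← sq_le_sq₀ (norm_nonneg _) (norm_nonneg _), hsq]
  exact sub_le_self _ (by positivity)

/-- The average of the damped projections onto the hyperplanes `yᗮ` over `y ∼ μ`: a contraction
that fixes exactly the vectors orthogonal to the support of `μ`. -/
noncomputable def meanDampedProjection [MeasurableSpace E] (μ : Measure E) : E →L[ℝ] E :=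
  ∫ y, dampedProjection y ∂μ

variable [MeasurableSpace E]

theorem norm_meanDampedProjection_le_one (μ : Measure E) [IsProbabilityMeasure μ] :
    ‖meanDampedProjection μ‖ ≤ 1 := by
  have h := norm_integral_le_of_norm_le_const (μ := μ) (.of_forall norm_dampedProjection_le_one)
  rwa [probReal_univ, one_mul] at h

variable [BorelSpace E] [SecondCountableTopology E]

theorem integrable_dampedProjection (μ : Measure E) [IsFiniteMeasure μ] :
    Integrable (dampedProjection (E := E)) μ :=
  .of_bound continuous_dampedProjection.aestronglyMeasurable 1
    (.of_forall norm_dampedProjection_le_one)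

variable [CompleteSpace E]

theorem inner_meanDampedProjection_self (μ : Measure E) [IsFiniteMeasure μ] (v : E) :
    inner ℝ v (meanDampedProjection μ v) =
      ∫ y, (‖v‖ ^ 2 - (1 + ‖y‖ ^ 2)⁻¹ * inner ℝ y v ^ 2) ∂μ := by
  have hint := integrable_dampedProjection μ
  rw [meanDampedProjection, ContinuousLinearMap.integral_apply hint,
    ← integral_inner (hint.apply_continuousLinearMap v)]
  simp only [inner_dampedProjection_self]

theorem meanDampedProjection_eq_self_iff (μ : Measure E) [IsProbabilityMeasure μ] (v : E) :
    meanDampedProjection μ v = v ↔ v ∈ (Submodule.span ℝ μ.support)ᗮ := by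
  have hint : Integrable (fun y => (1 + ‖y‖ ^ 2)⁻¹ * inner ℝ y v ^ 2) μ := by
    refine ((integrable_const (‖v‖ ^ 2)).sub <| ((integrable_dampedProjection
      μ).apply_continuousLinearMap v).const_inner (𝕜 := ℝ) v).congr (.of_forall fun y => ?_)
    simp only [Pi.sub_apply, inner_dampedProjection_self, sub_sub_cancel]
  rw [mem_orthogonal_span_iff]
  constructor
  · intro hfix
    have hzero : ∫ y, (1 + ‖y‖ ^ 2)⁻¹ * inner ℝ y v ^ 2 ∂μ = 0 := by
      have h := inner_meanDampedProjection_self μ v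
      rw [hfix, real_inner_self_eq_norm_sq, integral_sub (integrable_const _) hint,
        integral_const, probReal_univ, one_smul] at h
      linarith
    rw [integral_eq_zero_iff_of_nonneg (fun y => by positivity) hint] at hzero
    have hsupp : μ.support ⊆ {y | inner ℝ y v = 0} := by
      refine Measure.support_subset_of_isClosed (isClosed_eq (by fun_prop) continuous_const) ?_
      filter_upwards [hzero] with y hy
      have hdamp : (1 + ‖y‖ ^ 2)⁻¹ ≠ 0 := by positivity
      simpa [hdamp] using hy
    exact fun y hy => hsupp hy
  · intro hv
    have hfix : ∀ᵐ y ∂μ, dampedProjection y v = v := by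
      filter_upwards [Measure.support_mem_ae (μ := μ)] with y hy
      rw [dampedProjection_apply, hv y hy, mul_zero, zero_smul, sub_zero]
    rw [meanDampedProjection, ContinuousLinearMap.integral_apply (integrable_dampedProjection μ),
      integral_congr_ae hfix, integral_const, probReal_univ, one_smul]

theorem measurable_starProjection_orthogonal_span_support {Ω : Type*} [MeasurableSpace Ω]
    (κ : Kernel Ω E) [IsMarkovKernel κ] {ξ : Ω → E} (hξ : Measurable ξ) :
    Measurable fun ω => (Submodule.span ℝ (κ ω).support)ᗮ.starProjection (ξ ω) := by
  have hmean : StronglyMeasurable fun ω => meanDampedProjection (κ ω) :=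
    continuous_dampedProjection.stronglyMeasurable.integral_kernel
  have hiter (n : ℕ) : StronglyMeasurable fun ω => (meanDampedProjection (κ ω))^[n] (ξ ω) := by
    induction n with
    | zero => exact hξ.stronglyMeasurable
    | succ n ih =>
      simp only [Function.iterate_succ_apply']
      exact isBoundedBilinearMap_apply.continuous.comp_stronglyMeasurable (hmean.prodMk ih)
  have hfixed (ω : Ω) : (meanDampedProjection (κ ω)).eqLocus (1 : E →L[ℝ] E) =
      (Submodule.span ℝ (κ ω).support)ᗮ :=
    Submodule.ext fun v => meanDampedProjection_eq_self_iff (κ ω) v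
  have hlim (ω : Ω) := ContinuousLinearMap.tendsto_birkhoffAverage_orthogonalProjection
    (meanDampedProjection (κ ω)) (norm_meanDampedProjection_le_one (κ ω)) (ξ ω)
  simp only [← Submodule.starProjection_apply, hfixed] at hlim
  refine measurable_of_tendsto_metrizable (fun n => ?_) (tendsto_pi_nhds.2 hlim)
  exact ((Finset.stronglyMeasurable_fun_sum _ fun i _ => hiter i).const_smul _).measurable

end Projection

section SupportProjection

theorem ae_of_forall_condDistrib {Ω β E : Type*} [MeasurableSpace E] [StandardBorelSpace E]
    [Nonempty E] {m0 : MeasurableSpace Ω} {mβ : MeasurableSpace β} {P : Measure Ω}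
    [IsFiniteMeasure P] {X : Ω → β} {Y : Ω → E} (hX : Measurable X) (hY : Measurable Y)
    {p : β × E → Prop} (hp : MeasurableSet {z | p z})
    (h : ∀ b, ∀ᵐ y ∂condDistrib Y X P b, p (b, y)) : ∀ᵐ ω ∂P, p (X ω, Y ω) := by
  refine ae_of_ae_map (hX.prodMk hY).aemeasurable ?_
  rw [← compProd_map_condDistrib hY.aemeasurable]
  exact (Measure.ae_compProd_iff hp).2 (.of_forall h)

variable {Ω : Type*} {ℋ m0 : MeasurableSpace Ω} {P : Measure Ω} [IsFiniteMeasure P] {d : ℕ}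
  {Y ξ : Ω → EuclideanSpace ℝ (Fin d)}

theorem exists_mem_span_support_inner_eq (hH : ℋ ≤ m0) (hY : Measurable Y) (hξ : Measurable[ℋ] ξ) :
    ∃ η : Ω → EuclideanSpace ℝ (Fin d), Measurable[ℋ] η ∧
      (∀ ω, η ω ∈ Submodule.span ℝ (regCondDistrib ℋ P Y ω).support) ∧
      ∀ᵐ ω ∂P, inner ℝ (η ω) (Y ω) = inner ℝ (ξ ω) (Y ω) := by
  set κ := regCondDistrib ℋ P Y with hκ
  have hκmarkov : @IsMarkovKernel Ω (EuclideanSpace ℝ (Fin d)) ℋ _ κ := by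
    rw [hκ, regCondDistrib]; infer_instance
  let ζ (ω : Ω) := (Submodule.span ℝ (κ ω).support)ᗮ.starProjection (ξ ω)
  have hζ : Measurable[ℋ] ζ :=
    @measurable_starProjection_orthogonal_span_support _ _ _ _ _ _ _ Ω ℋ κ hκmarkov ξ hξ
  have hζY : ∀ᵐ ω ∂P, inner ℝ (Y ω) (ζ ω) = 0 := by
    have hset : MeasurableSet[ℋ.prod inferInstance]
        {p : Ω × EuclideanSpace ℝ (Fin d) | inner ℝ p.2 (ζ p.1) = 0} :=
      measurableSet_eq_fun (Measurable.inner measurable_snd (hζ.comp measurable_fst))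
        measurable_const
    refine @ae_of_forall_condDistrib Ω Ω _ _ _ _ m0 ℋ P _ id Y (measurable_id'' hH) hY _ hset ?_
    intro ω
    filter_upwards [Measure.support_mem_ae (μ := κ ω)] with y hy
    exact mem_orthogonal_span_iff.1 (Submodule.starProjection_apply_mem _ _) y hy
  refine ⟨fun ω => ξ ω - ζ ω, hξ.sub hζ, fun ω => ?_, ?_⟩
  · rw [← Submodule.orthogonal_orthogonal (Submodule.span ℝ (κ ω).support)]
    exact Submodule.sub_starProjection_mem_orthogonal _
  · filter_upwards [hζY] with ω hω
    rw [inner_sub_left, real_inner_comm (Y ω) (ζ ω), hω, sub_zero]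

theorem IsSupportSubspace.span_support_subset {D : Ω → Set (EuclideanSpace ℝ (Fin d))}
    (hD : IsSupportSubspace ℋ P Y D) :
    ∀ᵐ ω ∂P, (Submodule.span ℝ (regCondDistrib ℋ P Y ω).support :
      Set (EuclideanSpace ℝ (Fin d))) ⊆ D ω := by
  filter_upwards [hD.2] with ω ⟨⟨W, hW⟩, hspan⟩
  rw [hW, SetLike.coe_subset_coe, Submodule.span_le, ← hW, hspan]
  exact subset_affineSpan ℝ _

end SupportProjection

section RandomFunctions

variable {Ω : Type*} {ℋ m0 : MeasurableSpace Ω} {P : Measure Ω}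

theorem aemeasurable_comp_of_ae_continuous {ι β : Type*} [TopologicalSpace ι]
    [TopologicalSpace.MetrizableSpace ι] [SecondCountableTopology ι] [MeasurableSpace ι]
    [OpensMeasurableSpace ι] [TopologicalSpace β] [TopologicalSpace.PseudoMetrizableSpace β]
    [MeasurableSpace β] [BorelSpace β] {V : Ω → ι → β} (hcont : ∀ᵐ ω ∂P, Continuous (V ω))
    (hmeas : ∀ x, Measurable fun ω => V ω x) {Z : Ω → ι} (hZ : AEMeasurable Z P) :
    AEMeasurable (fun ω => V ω (Z ω)) P := by
  classical
  obtain _ | ⟨⟨ω₀⟩⟩ := isEmpty_or_nonempty Ω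
  · exact (measurable_of_empty _).aemeasurable
  obtain ⟨G, hGsub, hGm, hG⟩ := exists_measurable_superset_of_null (ae_iff.1 hcont)
  have hjoint : Measurable (Function.uncurry fun x ω => if ω ∈ G then V ω (Z ω₀) else V ω x) := by
    refine measurable_uncurry_of_continuous_of_measurable (fun ω => ?_) fun x =>
      .ite hGm (hmeas _) (hmeas x)
    split_ifs with hω
    · exact continuous_const
    · exact not_not.1 fun hc => hω (hGsub hc)
  refine (hjoint.comp_aemeasurable (hZ.prodMk aemeasurable_id)).congr ?_
  filter_upwards [measure_eq_zero_iff_ae_notMem.1 hG] with ω hω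
  exact if_neg hω

/-- The growth condition `U (λx) ≤ λ ^ γ U x + C λ ^ γ` for `λ ≥ 1`, which for a utility function
expresses a bound on its asymptotic elasticity. -/
def GrowthBound (C γ : ℝ) (U : ℝ → ℝ) : Prop :=
  ∀ ⦃x l : ℝ⦄, 1 ≤ l → U (l * x) ≤ l ^ γ * U x + C * l ^ γ

theorem GrowthBound.le_of_le_mul {C γ : ℝ} {U : ℝ → ℝ} (h : GrowthBound C γ U) (hU : Monotone U)
    {z l x : ℝ} (hl : 1 ≤ l) (hz : z ≤ l * x) : U z ≤ l ^ γ * (U x + C) := by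
  linarith [(hU hz).trans (h hl)]

theorem GrowthBound.rpow_le_neg {C γ : ℝ} {U : ℝ → ℝ} (h : GrowthBound C γ U) (hU : Monotone U)
    {n r z : ℝ} (hn : 0 < n) (hUn : U (-n) ≤ -C - 1) (hr : n ≤ r) (hz : z ≤ -r) :
    (r / n) ^ γ ≤ -U z := by
  have hl : 1 ≤ r / n := (one_le_div hn).2 hr
  have hle : U z ≤ (r / n) ^ γ * (U (-n) + C) :=
    h.le_of_le_mul hU hl (by rwa [mul_neg, div_mul_cancel₀ _ hn.ne'])
  have hpow : 0 ≤ (r / n) ^ γ := by positivity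
  nlinarith

variable {V : Ω → ℝ → ℝ} {C γ : ℝ}

theorem condLExp_ofReal_le_of_le_mul (hH : ℋ ≤ m0) [SigmaFinite (P.trim hH)]
    (hV : ∀ᵐ ω ∂P, Monotone (V ω)) (hgrowth : ∀ᵐ ω ∂P, GrowthBound C γ (V ω)) {Z W ρ : Ω → ℝ}
    (hρ : Measurable[ℋ] ρ) (hρ1 : ∀ ω, 1 ≤ ρ ω)
    (hW : AEMeasurable (fun ω => V ω (W ω)) P) (hZ : ∀ᵐ ω ∂P, Z ω ≤ ρ ω * W ω) :
    P⁻[fun ω => ENNReal.ofReal (V ω (Z ω)) | ℋ] ≤ᵐ[P] fun ω => ENNReal.ofReal (ρ ω ^ γ) *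
      (P⁻[fun ω => ENNReal.ofReal (V ω (W ω)) | ℋ] ω + ENNReal.ofReal C) := by
  have hle : (fun ω => ENNReal.ofReal (V ω (Z ω))) ≤ᵐ[P] fun ω => ENNReal.ofReal (ρ ω ^ γ) *
      ((fun ω => ENNReal.ofReal (V ω (W ω))) + fun _ => ENNReal.ofReal C : Ω → ℝ≥0∞) ω := by
    filter_upwards [hV, hgrowth, hZ] with ω hV hgrowth hZ
    rw [Pi.add_apply]
    calc ENNReal.ofReal (V ω (Z ω))
        ≤ ENNReal.ofReal (ρ ω ^ γ * (V ω (W ω) + C)) :=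
          ENNReal.ofReal_le_ofReal (hgrowth.le_of_le_mul hV (hρ1 ω) hZ)
      _ = ENNReal.ofReal (ρ ω ^ γ) * ENNReal.ofReal (V ω (W ω) + C) :=
          ENNReal.ofReal_mul (Real.rpow_nonneg (zero_le_one.trans (hρ1 ω)) γ)
      _ ≤ _ := by gcongr; exact ENNReal.ofReal_add_le
  filter_upwards [condLExp_mono (mΩ := ℋ) hle,
    condLExp_mul_left hH (hρ.pow_const γ).ennreal_ofReal (hW.ennreal_ofReal.add aemeasurable_const),
    condLExp_add_left (mΩ := ℋ) (fun _ => ENNReal.ofReal C) hW.ennreal_ofReal]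
    with ω hle hmul hadd
  rwa [hmul, hadd, Pi.add_apply, condLExp_const hH] at hle

theorem le_condLExp_ofReal_neg (hH : ℋ ≤ m0) [SigmaFinite (P.trim hH)]
    (hV : ∀ᵐ ω ∂P, Monotone (V ω)) (hgrowth : ∀ᵐ ω ∂P, GrowthBound C γ (V ω)) {Z n r : Ω → ℝ}
    (hn : Measurable[ℋ] n) (hr : Measurable[ℋ] r) (hnpos : ∀ ω, 0 < n ω)
    {A : Set Ω} (hA : NullMeasurableSet A P)
    (hVn : ∀ᵐ ω ∂P, ω ∈ A → V ω (-n ω) ≤ -C - 1) (hZ : ∀ᵐ ω ∂P, ω ∈ A → Z ω ≤ -r ω) :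
    ∀ᵐ ω ∂P, n ω ≤ r ω → ENNReal.ofReal ((r ω / n ω) ^ γ) * P⁻[A.indicator fun _ => 1|ℋ] ω ≤
      P⁻[fun ω => ENNReal.ofReal (-V ω (Z ω)) | ℋ] ω := by
  have hle : ∀ᵐ ω ∂P, n ω ≤ r ω →
      ENNReal.ofReal ((r ω / n ω) ^ γ) * A.indicator (fun _ => 1) ω ≤
        ENNReal.ofReal (-V ω (Z ω)) := by
    filter_upwards [hV, hgrowth, hVn, hZ] with ω hV hgrowth hVn hZ hnr
    by_cases hω : ω ∈ A
    · rw [Set.indicator_of_mem hω, mul_one]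
      exact ENNReal.ofReal_le_ofReal (hgrowth.rpow_le_neg hV (hnpos ω) (hVn hω) hnr (hZ hω))
    · simp only [Set.indicator_of_notMem hω, mul_zero, zero_le]
  filter_upwards [condLExp_mono_on hH (measurableSet_le hn hr) hle,
    condLExp_mul_left hH ((hr.div hn).pow_const γ).ennreal_ofReal
      (aemeasurable_const.indicator₀ hA)] with ω hle hmul hnr
  exact hmul.symm.le.trans (hle hnr)

end RandomFunctions

section PowerInequalities

variable {γ₁ γ₂ x M a b n G J ρ : ℝ}

theorem mul_rpow_sub_mul_rpow_le_neg (hγ₁ : 0 ≤ γ₁) (hγ : γ₁ < γ₂) (hb : 0 < b) (hG : 0 ≤ G)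
    (hJ : 0 ≤ J) (hρ : 1 ≤ ρ) (h : ((G + J) / b) ^ (γ₂ - γ₁)⁻¹ ≤ ρ) :
    G * ρ ^ γ₁ - b * ρ ^ γ₂ ≤ -J := by
  have hρ0 : 0 < ρ := zero_lt_one.trans_le hρ
  have hone : 1 ≤ ρ ^ γ₁ := Real.one_le_rpow hρ hγ₁
  have hpow : G + J ≤ ρ ^ (γ₂ - γ₁) * b := (div_le_iff₀ hb).1 <|
    (Real.rpow_inv_le_iff_of_pos (by positivity) hρ0.le (sub_pos.2 hγ)).1 h
  have hsplit : ρ ^ γ₂ = ρ ^ γ₁ * ρ ^ (γ₂ - γ₁) := by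
    rw [← Real.rpow_add hρ0, add_sub_cancel]
  rw [hsplit]
  nlinarith

/-- A bound on the size of the strategies that are worth considering when the initial capital is at
most `M` and not investing yields at least `-J`: see `le_neg_of_strategyBound_le`. -/
noncomputable def strategyBound (γ₁ γ₂ M a b n G J : ℝ) : ℝ :=
  max 1 (max (2 * M / a) (max (2 * n / a) (((G + J) / (b * (a / 2) ^ γ₂)) ^ (γ₂ - γ₁)⁻¹)))

theorem one_le_strategyBound : 1 ≤ strategyBound γ₁ γ₂ M a b n G J := le_max_left _ _

theorem le_neg_of_strategyBound_le (hγ₁ : 0 ≤ γ₁) (hγ : γ₁ < γ₂) (ha : 0 < a) (hb : 0 < b)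
    (hG : 0 ≤ G) (hJ : 0 ≤ J) (hx : x ≤ M) (h : strategyBound γ₁ γ₂ M a b n G J ≤ ρ) :
    n ≤ a * ρ - x ∧ G * max 1 ρ ^ γ₁ - b * (a * ρ - x) ^ γ₂ ≤ -J := by
  simp only [strategyBound, max_le_iff, div_le_iff₀ ha] at h
  obtain ⟨hρ, hM, hn, hpow⟩ := h
  have hhalf : a / 2 * ρ ≤ a * ρ - x := by linarith
  refine ⟨by linarith, ?_⟩
  calc G * max 1 ρ ^ γ₁ - b * (a * ρ - x) ^ γ₂
      ≤ G * ρ ^ γ₁ - b * (a / 2 * ρ) ^ γ₂ := by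
        rw [max_eq_right hρ]
        gcongr
        exact hγ₁.trans hγ.le
    _ = G * ρ ^ γ₁ - b * (a / 2) ^ γ₂ * ρ ^ γ₂ := by
        rw [Real.mul_rpow (by positivity) (by positivity), mul_assoc]
    _ ≤ -J := mul_rpow_sub_mul_rpow_le_neg hγ₁ hγ (by positivity) hG hJ hρ hpow

/-- A level of debt from which no strategy yields more than `-J`: large strategies do not because
of `strategyBound`, and small ones cannot make up for the debt: see `le_neg_of_le_neg_debtBound`. -/
noncomputable def debtBound (γ₁ γ₂ a b n G J : ℝ) : ℝ :=
  max 0 (max n (((J + G * strategyBound γ₁ γ₂ 0 a b n G J ^ γ₁) / b) ^ γ₂⁻¹))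

theorem debtBound_nonneg : 0 ≤ debtBound γ₁ γ₂ a b n G J := le_max_left _ _

theorem le_neg_of_le_neg_debtBound (hγ₁ : 0 ≤ γ₁) (hγ : γ₁ < γ₂) (ha : 0 < a) (hb : 0 < b)
    (hG : 0 ≤ G) (hJ : 0 ≤ J) (hρ : 0 ≤ ρ) (hx : x ≤ -debtBound γ₁ γ₂ a b n G J) :
    n ≤ a * ρ - x ∧ G * max 1 ρ ^ γ₁ - b * (a * ρ - x) ^ γ₂ ≤ -J := by
  have hdebt : debtBound γ₁ γ₂ a b n G J ≤ -x := le_neg.1 hx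
  simp only [debtBound, max_le_iff] at hdebt
  obtain ⟨hx0, hn, hpow⟩ := hdebt
  set K := strategyBound γ₁ γ₂ 0 a b n G J
  have hK : 1 ≤ K := one_le_strategyBound
  obtain hKρ | hρK := le_or_gt K ρ
  · exact le_neg_of_strategyBound_le hγ₁ hγ ha hb hG hJ (neg_nonneg.1 hx0) hKρ
  have hle : -x ≤ a * ρ - x := by linarith [mul_nonneg ha.le hρ]
  refine ⟨hn.trans hle, ?_⟩
  have hloss : J + G * K ^ γ₁ ≤ (-x) ^ γ₂ * b := (div_le_iff₀ hb).1 <|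
    (Real.rpow_inv_le_iff_of_pos (by positivity) hx0 (hγ₁.trans_lt hγ)).1 hpow
  calc G * max 1 ρ ^ γ₁ - b * (a * ρ - x) ^ γ₂
      ≤ G * K ^ γ₁ - b * (-x) ^ γ₂ := by
        gcongr
        · exact max_le hK hρK.le
        · exact hγ₁.trans hγ.le
    _ ≤ -J := by linarith

variable {α : Type*} {mα : MeasurableSpace α} {a b n G J : α → ℝ}

theorem measurable_strategyBound (ha : Measurable a) (hb : Measurable b) (hn : Measurable n)
    (hG : Measurable G) (hJ : Measurable J) :
    Measurable fun z => strategyBound γ₁ γ₂ M (a z) (b z) (n z) (G z) (J z) := by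
  unfold strategyBound
  fun_prop

theorem measurable_debtBound (ha : Measurable a) (hb : Measurable b) (hn : Measurable n)
    (hG : Measurable G) (hJ : Measurable J) :
    Measurable fun z => debtBound γ₁ γ₂ (a z) (b z) (n z) (G z) (J z) := by
  have hK := measurable_strategyBound (γ₁ := γ₁) (γ₂ := γ₂) (M := 0) ha hb hn hG hJ
  unfold debtBound
  fun_prop

end PowerInequalities

section Value

variable {Ω : Type*} {ℋ m0 : MeasurableSpace Ω} {P : Measure Ω} {d : ℕ} {V : Ω → ℝ → ℝ}
  {Y ξ : Ω → EuclideanSpace ℝ (Fin d)} {K X : Ω → ℝ}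

theorem neg_toReal_le_condUtility_zero (hV : ∀ᵐ ω ∂P, Monotone (V ω)) {M : ℝ}
    (hfin : ∀ᵐ ω ∂P, P⁻[fun ω => ENNReal.ofReal (-V ω (-M)) | ℋ] ω < ∞)
    (hX : ∀ᵐ ω ∂P, -M ≤ X ω) :
    ∀ᵐ ω ∂P, ((-(P⁻[fun ω => ENNReal.ofReal (-V ω (-M)) | ℋ] ω).toReal : ℝ) : EReal) ≤
      condUtility ℋ P V Y X 0 ω := by
  have hle : (fun ω => ENNReal.ofReal (-V ω (X ω + inner ℝ
      ((0 : Ω → EuclideanSpace ℝ (Fin d)) ω) (Y ω)))) ≤ᵐ[P]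
      fun ω => ENNReal.ofReal (-V ω (-M)) := by
    filter_upwards [hV, hX] with ω hV hX
    rw [Pi.zero_apply, inner_zero_left, add_zero]
    exact ENNReal.ofReal_le_ofReal (neg_le_neg (hV hX))
  filter_upwards [condLExp_mono (mΩ := ℋ) hle, hfin] with ω hle hfin
  refine le_trans ?_ (neg_toReal_le_genCondExp (hle.trans_lt hfin).ne)
  exact EReal.coe_le_coe_iff.2 (neg_le_neg (ENNReal.toReal_mono hfin.ne hle))

variable [IsFiniteMeasure P]

theorem condUtility_le_value (hξ : Measurable[ℋ] ξ) :
    condUtility ℋ P V Y X ξ ≤ᵐ[P] value ℋ P V Y X :=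
  (essSupFamily_spec P _).2.1 _ ⟨ξ, hξ, rfl⟩

theorem condUtility_le_valueBounded (hξ : Measurable[ℋ] ξ) (hK : ∀ᵐ ω ∂P, ‖ξ ω‖ ≤ K ω) :
    condUtility ℋ P V Y X ξ ≤ᵐ[P] valueBounded ℋ P V Y K X :=
  (essSupFamily_spec P _).2.1 _ ⟨ξ, hξ, hK, rfl⟩

theorem valueBounded_le {g : Ω → EReal} (hg : Measurable g)
    (h : ∀ ξ : Ω → EuclideanSpace ℝ (Fin d), Measurable[ℋ] ξ → (∀ᵐ ω ∂P, ‖ξ ω‖ ≤ K ω) →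
      condUtility ℋ P V Y X ξ ≤ᵐ[P] g) :
    valueBounded ℋ P V Y K X ≤ᵐ[P] g := by
  refine (essSupFamily_spec P _).2.2 g hg ?_
  rintro _ ⟨ξ, hξ, hξK, rfl⟩
  exact h ξ hξ hξK

theorem valueBounded_le_value : valueBounded ℋ P V Y K X ≤ᵐ[P] value ℋ P V Y X :=
  valueBounded_le (essSupFamily_spec P _).1 fun _ hξ _ => condUtility_le_value hξ

theorem value_le_on (hH : ℋ ≤ m0) (hY : Measurable Y) {s : Set Ω} (hs : MeasurableSet s)
    {g : Ω → EReal} (hg : Measurable g)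
    (h : ∀ η : Ω → EuclideanSpace ℝ (Fin d), Measurable[ℋ] η →
      (∀ ω, η ω ∈ Submodule.span ℝ (regCondDistrib ℋ P Y ω).support) →
      ∀ᵐ ω ∂P, ω ∈ s → condUtility ℋ P V Y X η ω ≤ g ω) :
    ∀ᵐ ω ∂P, ω ∈ s → value ℋ P V Y X ω ≤ g ω := by
  classical
  have hle : value ℋ P V Y X ≤ᵐ[P] s.piecewise g fun _ => ⊤ := by
    refine (essSupFamily_spec P _).2.2 _ (hg.piecewise hs measurable_const) ?_
    rintro _ ⟨ξ, hξ, rfl⟩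
    obtain ⟨η, hη, hηspan, hηY⟩ := exists_mem_span_support_inner_eq (P := P) hH hY hξ
    have hgain : condUtility ℋ P V Y X η =ᵐ[P] condUtility ℋ P V Y X ξ :=
      genCondExp_congr_ae (hηY.mono fun ω hω => by simp only [hω])
    filter_upwards [hgain, h η hη hηspan] with ω hgain hηg
    rw [← hgain]
    by_cases hω : ω ∈ s
    · rw [Set.piecewise_eq_of_mem _ _ _ hω]; exact hηg hω
    · rw [Set.piecewise_eq_of_notMem _ _ _ hω]; exact le_top
  filter_upwards [hle] with ω hle hω
  rwa [Set.piecewise_eq_of_mem _ _ _ hω] at hle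

theorem condUtility_indicator_eq (hH : ℋ ≤ m0) {s : Set Ω} (hs : MeasurableSet[ℋ] s) :
    condUtility ℋ P V Y X (s.indicator ξ) =ᵐ[P]
      s.indicator (condUtility ℋ P V Y X ξ) + sᶜ.indicator (condUtility ℋ P V Y X 0) := by
  filter_upwards [genCondExp_congr_on (P := P) hH hs
      (Z := fun ω => V ω (X ω + inner ℝ (s.indicator ξ ω) (Y ω)))
      (Z' := fun ω => V ω (X ω + inner ℝ (ξ ω) (Y ω)))
      (.of_forall fun ω hω => by rw [Set.indicator_of_mem hω]),
    genCondExp_congr_on (P := P) hH hs.compl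
      (Z := fun ω => V ω (X ω + inner ℝ (s.indicator ξ ω) (Y ω)))
      (Z' := fun ω => V ω (X ω + inner ℝ ((0 : Ω → EuclideanSpace ℝ (Fin d)) ω) (Y ω)))
      (.of_forall fun ω hω => by rw [Set.indicator_of_notMem hω, Pi.zero_apply])]
    with ω hin hout
  by_cases hω : ω ∈ s
  · simpa [condUtility, hω] using hin hω
  · simpa [condUtility, hω] using hout hω

theorem value_le_valueBounded (hH : ℋ ≤ m0) (hY : Measurable Y) (hK : Measurable[ℋ] K)
    (hK0 : ∀ ω, 0 ≤ K ω)
    (h : ∀ η : Ω → EuclideanSpace ℝ (Fin d), Measurable[ℋ] η →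
      (∀ ω, η ω ∈ Submodule.span ℝ (regCondDistrib ℋ P Y ω).support) →
      ∀ᵐ ω ∂P, K ω < ‖η ω‖ → condUtility ℋ P V Y X η ω ≤ condUtility ℋ P V Y X 0 ω) :
    value ℋ P V Y X ≤ᵐ[P] valueBounded ℋ P V Y K X := by
  suffices hle : ∀ᵐ ω ∂P, ω ∈ Set.univ → value ℋ P V Y X ω ≤ valueBounded ℋ P V Y K X ω from
    hle.mono fun ω hω => hω trivial
  refine value_le_on hH hY .univ (essSupFamily_spec P _).1 fun η hη hηspan => ?_
  let s := {ω | ‖η ω‖ ≤ K ω}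
  have hs : MeasurableSet[ℋ] s := measurableSet_le (measurable_norm.comp hη) hK
  have hbound (ω : Ω) : ‖s.indicator η ω‖ ≤ K ω := by
    by_cases hω : ω ∈ s
    · rw [Set.indicator_of_mem hω]; exact hω
    · rw [Set.indicator_of_notMem hω, norm_zero]; exact hK0 ω
  filter_upwards [h η hη hηspan, condUtility_indicator_eq hH hs,
    condUtility_le_valueBounded (hη.indicator hs) (.of_forall hbound)]
    with ω hlarge hcut hle _
  refine le_trans ?_ hle
  rw [hcut]
  by_cases hω : ω ∈ s
  · simp [hω]
  · simpa [hω] using hlarge (not_le.1 hω)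

end Value

section Domination

variable {Ω : Type*} {ℋ m0 : MeasurableSpace Ω} {P : Measure Ω} [IsFiniteMeasure P] {d : ℕ}
  {V : Ω → ℝ → ℝ} {Y ξ : Ω → EuclideanSpace ℝ (Fin d)} {X α β N : Ω → ℝ} {C γ M : ℝ}

theorem ofReal_half_le_condLExp_indicator_inter (hH : ℋ ≤ m0) {s t : Set Ω}
    (hs : NullMeasurableSet s P) (ht : NullMeasurableSet t P)
    (hβs : ∀ᵐ ω ∂P, β ω ≤ P[s.indicator fun _ => (1 : ℝ) | ℋ] ω)
    (hβt : ∀ᵐ ω ∂P, 1 - β ω / 2 ≤ P[t.indicator fun _ => (1 : ℝ) | ℋ] ω) :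
    ∀ᵐ ω ∂P, ENNReal.ofReal (β ω / 2) ≤ P⁻[(s ∩ t).indicator fun _ => 1|ℋ] ω := by
  filter_upwards [hβs, hβt, condExp_indicator_add_le_one_add_inter hH hs ht,
    condLExp_indicator_one (hs.inter ht)] with ω hβs hβt hadd hinter
  rw [hinter]
  exact ENNReal.ofReal_le_ofReal (by linarith)

theorem condLExp_ofReal_gain_le (hH : ℋ ≤ m0) (hY : Measurable Y)
    (hV : ∀ᵐ ω ∂P, Monotone (V ω) ∧ Continuous (V ω)) (hVmeas : ∀ x, Measurable fun ω => V ω x)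
    (hC : 0 ≤ C) (hgrowth : ∀ᵐ ω ∂P, GrowthBound C γ (V ω)) (hM : 0 ≤ M)
    (hfin : ∀ᵐ ω ∂P, P⁻[fun ω => ENNReal.ofReal (V ω (M + ‖Y ω‖)) | ℋ] ω < ∞)
    (hX : ∀ᵐ ω ∂P, X ω ≤ M) (hξ : Measurable[ℋ] ξ) :
    ∀ᵐ ω ∂P, P⁻[fun ω => ENNReal.ofReal (V ω (X ω + inner ℝ (ξ ω) (Y ω))) | ℋ] ω ≤
      ENNReal.ofReal (((P⁻[fun ω => ENNReal.ofReal (V ω (M + ‖Y ω‖)) | ℋ] ω).toReal + C) *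
        max 1 ‖ξ ω‖ ^ γ) := by
  have hZ : ∀ᵐ ω ∂P, X ω + inner ℝ (ξ ω) (Y ω) ≤ max 1 ‖ξ ω‖ * (M + ‖Y ω‖) := by
    filter_upwards [hX] with ω hX
    calc X ω + inner ℝ (ξ ω) (Y ω) ≤ 1 * M + ‖ξ ω‖ * ‖Y ω‖ := by
          rw [one_mul]; exact add_le_add hX (real_inner_le_norm _ _)
      _ ≤ max 1 ‖ξ ω‖ * (M + ‖Y ω‖) := by
          rw [mul_add]; gcongr <;> simp
  have hW : AEMeasurable (fun ω => V ω (M + ‖Y ω‖)) P :=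
    aemeasurable_comp_of_ae_continuous (hV.mono fun _ h => h.2) hVmeas
      (hY.norm.const_add M).aemeasurable
  filter_upwards [hfin, condLExp_ofReal_le_of_le_mul hH (hV.mono fun _ h => h.1) hgrowth
    (measurable_const.max (measurable_norm.comp hξ)) (fun ω => le_max_left 1 ‖ξ ω‖) hW hZ]
    with ω hfin hle
  rwa [mul_comm (_ + C), ENNReal.ofReal_mul (by positivity),
    ENNReal.ofReal_add ENNReal.toReal_nonneg hC, ENNReal.ofReal_toReal hfin.ne]

theorem ofReal_le_condLExp_ofReal_loss (hH : ℋ ≤ m0) (hY : Measurable Y)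
    (hV : ∀ᵐ ω ∂P, Monotone (V ω) ∧ Continuous (V ω)) (hVmeas : ∀ x, Measurable fun ω => V ω x)
    (hC : 0 ≤ C) (hgrowth : ∀ᵐ ω ∂P, GrowthBound C γ (V ω)) (hα : Measurable[ℋ] α)
    (hβ : Measurable[ℋ] β) (hβpos : ∀ᵐ ω ∂P, 0 < β ω) (hN : Measurable[ℋ] N)
    (hVN : ∀ᵐ ω ∂P, 1 - β ω / 2 ≤
      P[{ω | V ω (-N ω) < -(2 * C / β ω) - 1}.indicator fun _ => (1 : ℝ) | ℋ] ω)
    (hX : Measurable[ℋ] X) (hξ : Measurable[ℋ] ξ)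
    (hNA : ∀ᵐ ω ∂P, β ω ≤
      P[{ω | inner ℝ (ξ ω) (Y ω) ≤ -α ω * ‖ξ ω‖}.indicator fun _ => (1 : ℝ) | ℋ] ω) :
    ∀ᵐ ω ∂P, max 1 (N ω) ≤ α ω * ‖ξ ω‖ - X ω →
      ENNReal.ofReal (β ω / 2 / max 1 (N ω) ^ γ * (α ω * ‖ξ ω‖ - X ω) ^ γ) ≤
        P⁻[fun ω => ENNReal.ofReal (-V ω (X ω + inner ℝ (ξ ω) (Y ω))) | ℋ] ω := by
  set s := {ω | inner ℝ (ξ ω) (Y ω) ≤ -α ω * ‖ξ ω‖}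
  set t := {ω | V ω (-N ω) < -(2 * C / β ω) - 1}
  have hs : NullMeasurableSet s P :=
    (measurableSet_le ((hξ.mono hH le_rfl).inner hY)
      ((hα.neg.mul (measurable_norm.comp hξ)).mono hH le_rfl)).nullMeasurableSet
  have ht : NullMeasurableSet t P := nullMeasurableSet_lt
    (aemeasurable_comp_of_ae_continuous (hV.mono fun _ h => h.2) hVmeas
      (hN.neg.mono hH le_rfl).aemeasurable)
    (((hβ.const_div (2 * C)).neg.sub_const 1).mono hH le_rfl).aemeasurable
  have hVn : ∀ᵐ ω ∂P, ω ∈ s ∩ t → V ω (-max 1 (N ω)) ≤ -C - 1 := by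
    filter_upwards [hV, hβpos, hNA, condExp_indicator_one_le_one hH hs]
      with ω hV hβpos hNA hle hω
    have hβC : C ≤ 2 * C / β ω := (le_div_iff₀ hβpos).2 (by nlinarith [hNA.trans hle])
    have hVN : V ω (-N ω) < -(2 * C / β ω) - 1 := hω.2
    linarith [hV.1 (neg_le_neg (le_max_right 1 (N ω)))]
  have hZ : ∀ᵐ ω ∂P, ω ∈ s ∩ t → X ω + inner ℝ (ξ ω) (Y ω) ≤ -(α ω * ‖ξ ω‖ - X ω) :=
    .of_forall fun ω hω => by
      have hs : inner ℝ (ξ ω) (Y ω) ≤ -α ω * ‖ξ ω‖ := hω.1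
      linarith
  filter_upwards [ofReal_half_le_condLExp_indicator_inter hH hs ht hNA hVN,
    le_condLExp_ofReal_neg hH (hV.mono fun _ h => h.1) hgrowth (measurable_const.max hN)
      ((hα.mul (measurable_norm.comp hξ)).sub hX) (fun ω => lt_max_of_lt_left one_pos)
      (hs.inter ht) hVn hZ]
    with ω hprob hloss hnr
  refine le_trans ?_ (hloss hnr)
  have hr : 0 ≤ α ω * ‖ξ ω‖ - X ω := (zero_le_one.trans (le_max_left _ _)).trans hnr
  calc ENNReal.ofReal (β ω / 2 / max 1 (N ω) ^ γ * (α ω * ‖ξ ω‖ - X ω) ^ γ)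
      = ENNReal.ofReal (((α ω * ‖ξ ω‖ - X ω) / max 1 (N ω)) ^ γ) * ENNReal.ofReal (β ω / 2) := by
        rw [← ENNReal.ofReal_mul (by positivity), Real.div_rpow hr (by positivity)]
        ring_nf
    _ ≤ _ := mul_le_mul' le_rfl hprob

/-- For capital at most `M`, a strategy `ξ` has expected utility at most `G max(1, |ξ|) ^ γ₁`, and
at most `G max(1, |ξ|) ^ γ₁ - b (a |ξ| - X) ^ γ₂` if it lies in the span of the support of the
conditional distribution of `Y` and the loss `a |ξ| - X` that it risks is at least `n`. -/
structure PowerDomination (ℋ : MeasurableSpace Ω) {m0 : MeasurableSpace Ω} (P : Measure Ω)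
    [IsFiniteMeasure P] (V : Ω → ℝ → ℝ) (Y : Ω → EuclideanSpace ℝ (Fin d)) (M γ₁ γ₂ : ℝ)
    (a b n G : Ω → ℝ) : Prop where
  measurable_a : Measurable[ℋ] a
  measurable_b : Measurable[ℋ] b
  measurable_n : Measurable[ℋ] n
  measurable_G : Measurable[ℋ] G
  a_pos : ∀ᵐ ω ∂P, 0 < a ω
  b_pos : ∀ᵐ ω ∂P, 0 < b ω
  G_nonneg : ∀ ω, 0 ≤ G ω
  condUtility_le {X : Ω → ℝ} {ξ : Ω → EuclideanSpace ℝ (Fin d)} (hX : ∀ᵐ ω ∂P, X ω ≤ M)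
    (hξ : Measurable[ℋ] ξ) :
    ∀ᵐ ω ∂P, condUtility ℋ P V Y X ξ ω ≤ ((G ω * max 1 ‖ξ ω‖ ^ γ₁ : ℝ) : EReal)
  condUtility_le_sub {X : Ω → ℝ} {ξ : Ω → EuclideanSpace ℝ (Fin d)} (hX : ∀ᵐ ω ∂P, X ω ≤ M)
    (hXmeas : Measurable[ℋ] X) (hξ : Measurable[ℋ] ξ)
    (hspan : ∀ ω, ξ ω ∈ Submodule.span ℝ (regCondDistrib ℋ P Y ω).support) :
    ∀ᵐ ω ∂P, n ω ≤ a ω * ‖ξ ω‖ - X ω → condUtility ℋ P V Y X ξ ω ≤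
      ((G ω * max 1 ‖ξ ω‖ ^ γ₁ - b ω * (a ω * ‖ξ ω‖ - X ω) ^ γ₂ : ℝ) : EReal)

theorem powerDomination (hH : ℋ ≤ m0) (hY : Measurable Y)
    (hα : Measurable[ℋ] α) (hβ : Measurable[ℋ] β)
    (hαpos : ∀ᵐ ω ∂P, 0 < α ω) (hβpos : ∀ᵐ ω ∂P, 0 < β ω)
    (hNA : ∀ ξ : Ω → EuclideanSpace ℝ (Fin d), Measurable[ℋ] ξ →
      (∀ ω, ξ ω ∈ Submodule.span ℝ (regCondDistrib ℋ P Y ω).support) → ∀ᵐ ω ∂P, β ω ≤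
        P[{ω | inner ℝ (ξ ω) (Y ω) ≤ -α ω * ‖ξ ω‖}.indicator fun _ => (1 : ℝ) | ℋ] ω)
    (hV : ∀ᵐ ω ∂P, Monotone (V ω) ∧ Continuous (V ω)) (hVmeas : ∀ x, Measurable fun ω => V ω x)
    {γ₁ γ₂ : ℝ} (hC : 0 ≤ C) (hgrowth₁ : ∀ᵐ ω ∂P, GrowthBound C γ₁ (V ω))
    (hgrowth₂ : ∀ᵐ ω ∂P, GrowthBound C γ₂ (V ω)) (hN : Measurable[ℋ] N)
    (hVN : ∀ᵐ ω ∂P, 1 - β ω / 2 ≤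
      P[{ω | V ω (-N ω) < -(2 * C / β ω) - 1}.indicator fun _ => (1 : ℝ) | ℋ] ω) (hM : 0 ≤ M)
    (hfin : ∀ᵐ ω ∂P, P⁻[fun ω => ENNReal.ofReal (V ω (M + ‖Y ω‖)) | ℋ] ω < ∞) :
    PowerDomination ℋ P V Y M γ₁ γ₂ α (fun ω => β ω / 2 / max 1 (N ω) ^ γ₂)
      (fun ω => max 1 (N ω))
      fun ω => (P⁻[fun ω => ENNReal.ofReal (V ω (M + ‖Y ω‖)) | ℋ] ω).toReal + C where
  measurable_a := hα
  measurable_b := (hβ.div_const 2).div ((measurable_const.max hN).pow_const γ₂)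
  measurable_n := measurable_const.max hN
  measurable_G := (measurable_condLExp ℋ P _).ennreal_toReal.add_const C
  a_pos := hαpos
  b_pos := hβpos.mono fun ω hω => by positivity
  G_nonneg ω := by positivity
  condUtility_le {X ξ} hX hξ := by
    filter_upwards [condLExp_ofReal_gain_le hH hY hV hVmeas hC hgrowth₁ hM hfin hX hξ] with ω hgain
    exact (genCondExp_le_sub (by positivity) le_rfl hgain
      (ENNReal.ofReal_zero.trans_le zero_le)).trans_eq (by rw [sub_zero])
  condUtility_le_sub {X ξ} hX hXmeas hξ hspan := by
    filter_upwards [hβpos, condLExp_ofReal_gain_le hH hY hV hVmeas hC hgrowth₁ hM hfin hX hξ,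
      ofReal_le_condLExp_ofReal_loss hH hY hV hVmeas hC hgrowth₂ hα hβ hβpos hN hVN hXmeas hξ
        (hNA ξ hξ hspan)] with ω hβpos hgain hloss hn
    have hr : 0 ≤ α ω * ‖ξ ω‖ - X ω := (zero_le_one.trans (le_max_left _ _)).trans hn
    exact genCondExp_le_sub (by positivity) (by positivity) hgain (hloss hn)

end Domination

section Optimality

variable {Ω : Type*} {ℋ m0 : MeasurableSpace Ω} {P : Measure Ω} {d : ℕ} {V : Ω → ℝ → ℝ}
  {Y : Ω → EuclideanSpace ℝ (Fin d)} {M γ₁ γ₂ : ℝ} {a b n G X : Ω → ℝ}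

theorem ae_le_of_forall_nat {w : Ω → ℝ → EReal} {v : ℝ → Ω → EReal}
    (hw : ∀ x, (fun ω => w ω x) =ᵐ[P] v x) (hmono : ∀ᵐ ω ∂P, Monotone (w ω)) {N : Ω → ℝ}
    (hN : ∀ ω, 0 ≤ N ω) {g : Ω → EReal} (h : ∀ k : ℕ, ∀ᵐ ω ∂P, N ω ≤ k → v (-k) ω ≤ g ω) :
    ∀ᵐ ω ∂P, w ω (-(N ω + 1)) ≤ g ω := by
  filter_upwards [hmono, ae_all_iff.2 h, ae_all_iff.2 fun k : ℕ => hw (-k)] with ω hmono h hw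
  calc w ω (-(N ω + 1)) ≤ w ω (-⌈N ω⌉₊) := hmono (neg_le_neg (Nat.ceil_lt_add_one (hN ω)).le)
    _ = v (-⌈N ω⌉₊) ω := hw _
    _ ≤ g ω := h _ (Nat.le_ceil _)

variable [IsFiniteMeasure P]

theorem bot_lt_value (hV : ∀ᵐ ω ∂P, Monotone (V ω))
    (hfin : ∀ᵐ ω ∂P, P⁻[fun ω => ENNReal.ofReal (-V ω (-M)) | ℋ] ω < ∞)
    (hX : ∀ᵐ ω ∂P, -M ≤ X ω) : ∀ᵐ ω ∂P, ⊥ < value ℋ P V Y X ω := by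
  filter_upwards [neg_toReal_le_condUtility_zero (Y := Y) hV hfin hX,
    condUtility_le_value (P := P) (ξ := 0) measurable_const] with ω hzero hle
  exact (EReal.bot_lt_coe _).trans_le (hzero.trans hle)

namespace PowerDomination

theorem exists_value_ae_eq_valueBounded (h : PowerDomination ℋ P V Y M γ₁ γ₂ a b n G)
    (hH : ℋ ≤ m0) (hY : Measurable Y) (hV : ∀ᵐ ω ∂P, Monotone (V ω))
    (hfin : ∀ᵐ ω ∂P, P⁻[fun ω => ENNReal.ofReal (-V ω (-M)) | ℋ] ω < ∞) (hγ₁ : 0 ≤ γ₁)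
    (hγ : γ₁ < γ₂) : ∃ K : Ω → ℝ, Measurable[ℋ] K ∧ (∀ ω, 0 < K ω) ∧
      ∀ X : Ω → ℝ, Measurable[ℋ] X → (∀ᵐ ω ∂P, |X ω| ≤ M) →
        value ℋ P V Y X =ᵐ[P] valueBounded ℋ P V Y K X := by
  let K (ω : Ω) := strategyBound γ₁ γ₂ M (a ω) (b ω) (n ω) (G ω)
    (P⁻[fun ω => ENNReal.ofReal (-V ω (-M)) | ℋ] ω).toReal
  have hK : Measurable[ℋ] K := measurable_strategyBound h.measurable_a h.measurable_b
    h.measurable_n h.measurable_G (measurable_condLExp ℋ P _).ennreal_toReal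
  have hKpos (ω : Ω) : 0 < K ω := zero_lt_one.trans_le one_le_strategyBound
  refine ⟨K, hK, hKpos, fun X hX hXM => Filter.EventuallyLE.antisymm ?_ valueBounded_le_value⟩
  have hle : ∀ᵐ ω ∂P, X ω ≤ M := hXM.mono fun ω hω => (abs_le.1 hω).2
  refine value_le_valueBounded hH hY hK (fun ω => (hKpos ω).le) fun η hη hspan => ?_
  filter_upwards [h.a_pos, h.b_pos, hle, h.condUtility_le_sub hle hX hη hspan,
    neg_toReal_le_condUtility_zero hV hfin (hXM.mono fun ω hω => (abs_le.1 hω).1)]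
    with ω ha hb hle hη hzero hlarge
  obtain ⟨hn, hneg⟩ := le_neg_of_strategyBound_le hγ₁ hγ ha hb (h.G_nonneg ω)
    ENNReal.toReal_nonneg hle hlarge.le
  exact (hη hn).trans ((EReal.coe_le_coe_iff.2 hneg).trans hzero)

theorem valueBounded_lt_top (h : PowerDomination ℋ P V Y M γ₁ γ₂ a b n G) (hH : ℋ ≤ m0)
    (hγ₁ : 0 ≤ γ₁) {K : Ω → ℝ} (hK : Measurable[ℋ] K) (hX : ∀ᵐ ω ∂P, X ω ≤ M) :
    ∀ᵐ ω ∂P, valueBounded ℋ P V Y K X ω < ⊤ := by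
  have hg : Measurable fun ω => ((G ω * max 1 (K ω) ^ γ₁ : ℝ) : EReal) :=
    ((h.measurable_G.mul ((measurable_const.max hK).pow_const γ₁)).mono hH le_rfl).coe_real_ereal
  have hle := valueBounded_le (ℋ := ℋ) (V := V) (Y := Y) (K := K) (X := X) hg
    fun ξ hξ hξK => by
      filter_upwards [hξK, h.condUtility_le hX hξ] with ω hξK hle
      refine hle.trans (EReal.coe_le_coe_iff.2 ?_)
      gcongr
      exact h.G_nonneg ω
  exact hle.mono fun ω hω => hω.trans_lt (EReal.coe_lt_top _)

theorem value_lt_top (h : PowerDomination ℋ P V Y M γ₁ γ₂ a b n G) (hH : ℋ ≤ m0)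
    (hY : Measurable Y) (hV : ∀ᵐ ω ∂P, Monotone (V ω))
    (hfin : ∀ᵐ ω ∂P, P⁻[fun ω => ENNReal.ofReal (-V ω (-M)) | ℋ] ω < ∞) (hγ₁ : 0 ≤ γ₁)
    (hγ : γ₁ < γ₂) (hX : Measurable[ℋ] X) (hXM : ∀ᵐ ω ∂P, |X ω| ≤ M) :
    ∀ᵐ ω ∂P, value ℋ P V Y X ω < ⊤ := by
  obtain ⟨K, hK, -, hvalue⟩ := h.exists_value_ae_eq_valueBounded hH hY hV hfin hγ₁ hγ
  filter_upwards [hvalue X hX hXM,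
    h.valueBounded_lt_top hH hγ₁ hK (hXM.mono fun ω hω => (abs_le.1 hω).2)] with ω heq hlt
  rwa [heq]

theorem value_le_neg_of_le_neg_debtBound (h : PowerDomination ℋ P V Y M γ₁ γ₂ a b n G)
    (hH : ℋ ≤ m0) (hY : Measurable Y) (hγ₁ : 0 ≤ γ₁) (hγ : γ₁ < γ₂) {J : Ω → ℝ}
    (hJ : Measurable[ℋ] J) (hJ0 : ∀ ω, 0 ≤ J ω) (hX : Measurable[ℋ] X)
    (hXM : ∀ᵐ ω ∂P, X ω ≤ M) :
    ∀ᵐ ω ∂P, X ω ≤ -debtBound γ₁ γ₂ (a ω) (b ω) (n ω) (G ω) (J ω) →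
      value ℋ P V Y X ω ≤ ((-J ω : ℝ) : EReal) := by
  have hdebt : Measurable[ℋ] fun ω => debtBound γ₁ γ₂ (a ω) (b ω) (n ω) (G ω) (J ω) :=
    measurable_debtBound h.measurable_a h.measurable_b h.measurable_n h.measurable_G hJ
  refine value_le_on hH hY (hH _ (measurableSet_le hX hdebt.neg))
    (hJ.neg.mono hH le_rfl).coe_real_ereal fun η hη hspan => ?_
  filter_upwards [h.a_pos, h.b_pos, h.condUtility_le_sub hXM hX hη hspan] with ω ha hb hle hω
  obtain ⟨hn, hneg⟩ := le_neg_of_le_neg_debtBound hγ₁ hγ ha hb (h.G_nonneg ω) (hJ0 ω)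
    (norm_nonneg (η ω)) hω
  exact (hle hn).trans (EReal.coe_le_coe_iff.2 hneg)

theorem exists_value_neg_le (h : PowerDomination ℋ P V Y 0 γ₁ γ₂ a b n G)
    (hH : ℋ ≤ m0) (hY : Measurable Y) (hγ₁ : 0 ≤ γ₁) (hγ : γ₁ < γ₂) {I : Ω → ℝ}
    (hI : Measurable[ℋ] I) : ∃ N : Ω → ℝ, Measurable[ℋ] N ∧ (∀ ω, 0 < N ω) ∧
      (∀ᵐ ω ∂P, value ℋ P V Y (fun ω => -N ω) ω ≤ ((-I ω : ℝ) : EReal)) ∧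
      ∀ w : Ω → ℝ → EReal, (∀ x, (fun ω => w ω x) =ᵐ[P] value ℋ P V Y fun _ => x) →
        (∀ᵐ ω ∂P, Monotone (w ω)) → ∀ᵐ ω ∂P, w ω (-N ω) ≤ ((-I ω : ℝ) : EReal) := by
  let J (ω : Ω) := max 0 (I ω)
  have hJ : Measurable[ℋ] J := measurable_const.max hI
  let N₀ (ω : Ω) := debtBound γ₁ γ₂ (a ω) (b ω) (n ω) (G ω) (J ω)
  have hN₀ : Measurable[ℋ] N₀ :=
    measurable_debtBound h.measurable_a h.measurable_b h.measurable_n h.measurable_G hJ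
  have hN₀0 (ω : Ω) : 0 ≤ N₀ ω := debtBound_nonneg
  have hJI (ω : Ω) : ((-J ω : ℝ) : EReal) ≤ ((-I ω : ℝ) : EReal) :=
    EReal.coe_le_coe_iff.2 (neg_le_neg (le_max_right _ _))
  have hvalue {X : Ω → ℝ} (hX : Measurable[ℋ] X) (hX0 : ∀ᵐ ω ∂P, X ω ≤ 0) :
      ∀ᵐ ω ∂P, X ω ≤ -N₀ ω → value ℋ P V Y X ω ≤ ((-I ω : ℝ) : EReal) :=
    (h.value_le_neg_of_le_neg_debtBound hH hY hγ₁ hγ hJ (fun _ => le_max_left _ _) hX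
      hX0).mono fun ω hle hω => (hle hω).trans (hJI ω)
  have hpos (ω : Ω) : 0 < N₀ ω + 1 := add_pos_of_nonneg_of_pos (hN₀0 ω) one_pos
  refine ⟨fun ω => N₀ ω + 1, hN₀.add_const 1, hpos, ?_,
    fun w hw hmono => ae_le_of_forall_nat hw hmono hN₀0 fun k => ?_⟩
  · filter_upwards [hvalue (hN₀.add_const 1).neg (.of_forall fun ω => neg_nonpos.2 (hpos ω).le)]
      with ω hle
    exact hle (neg_le_neg (le_add_of_nonneg_right zero_le_one))
  · filter_upwards [hvalue (X := fun _ => -(k : ℝ)) measurable_const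
      (.of_forall fun _ => neg_nonpos.2 k.cast_nonneg)] with ω hle hω
    exact hle (neg_le_neg hω)

end PowerDomination

end Optimality

end OneStep

open OneStep in
theorem lemma3p1_general {Ω : Type*} (ℋ : MeasurableSpace Ω) {m0 : MeasurableSpace Ω}
    (P : Measure Ω) [IsFiniteMeasure P] (hH : ℋ ≤ m0) {d : ℕ} (Y : Ω → EuclideanSpace ℝ (Fin d))
    (hY : Measurable Y) (α β : Ω → ℝ) (hα : Measurable[ℋ] α) (hβ : Measurable[ℋ] β)
    (hαpos : ∀ᵐ ω ∂P, 0 < α ω) (hβpos : ∀ᵐ ω ∂P, 0 < β ω)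
    (hNA : ∀ ξ : Ω → EuclideanSpace ℝ (Fin d), Measurable[ℋ] ξ →
      (∀ ω, ξ ω ∈ Submodule.span ℝ (regCondDistrib ℋ P Y ω).support) → ∀ᵐ ω ∂P, β ω ≤
        P[{ω | inner ℝ (ξ ω) (Y ω) ≤ -α ω * ‖ξ ω‖}.indicator fun _ => (1 : ℝ)|ℋ] ω)
    (V : Ω → ℝ → ℝ) (hV : ∀ᵐ ω ∂P, Monotone (V ω) ∧ Continuous (V ω))
    (hVmeas : ∀ x, Measurable fun ω => V ω x)
    (hVneg : ∀ x, ∀ᵐ ω ∂P, P⁻[fun ω => ENNReal.ofReal (-V ω x)|ℋ] ω < ∞)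
    (hVpos : ∀ x, ∀ᵐ ω ∂P, P⁻[fun ω => ENNReal.ofReal (V ω (x + ‖Y ω‖))|ℋ] ω < ∞)
    (C γ₁ γ₂ : ℝ) (hC : 0 ≤ C) (hγ₁ : 0 ≤ γ₁) (hγ : γ₁ < γ₂)
    (hgrowth : ∀ᵐ ω ∂P, GrowthBound C γ₁ (V ω) ∧ GrowthBound C γ₂ (V ω))
    (N : Ω → ℝ) (hN : Measurable[ℋ] N)
    (hVN : ∀ᵐ ω ∂P, 1 - β ω / 2 ≤
      P[{ω | V ω (-N ω) < -(2 * C / β ω) - 1}.indicator fun _ => (1 : ℝ)|ℋ] ω) :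
    (∀ x₀ x₁ : ℝ, ∃ K : Ω → ℝ, Measurable[ℋ] K ∧ (∀ ω, 0 < K ω) ∧ ∀ x ∈ Set.Icc x₀ x₁,
      value ℋ P V Y (fun _ => x) =ᵐ[P] valueBounded ℋ P V Y K fun _ => x) ∧
    (∀ x : ℝ, ∀ᵐ ω ∂P,
      ⊥ < value ℋ P V Y (fun _ => x) ω ∧ value ℋ P V Y (fun _ => x) ω < ⊤) ∧
    ∀ I : Ω → ℝ, Measurable[ℋ] I → ∃ N' : Ω → ℝ, Measurable[ℋ] N' ∧ (∀ ω, 0 < N' ω) ∧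
      (∀ᵐ ω ∂P, value ℋ P V Y (fun ω => -N' ω) ω ≤ ((-I ω : ℝ) : EReal)) ∧
      ∀ w : Ω → ℝ → EReal, (∀ x, (fun ω => w ω x) =ᵐ[P] value ℋ P V Y fun _ => x) →
        (∀ᵐ ω ∂P, Monotone (w ω)) → ∀ᵐ ω ∂P, w ω (-N' ω) ≤ ((-I ω : ℝ) : EReal) := by
  have hmono : ∀ᵐ ω ∂P, Monotone (V ω) := hV.mono fun _ h => h.1
  have hdom {M : ℝ} (hM : 0 ≤ M) := powerDomination hH hY hα hβ hαpos hβpos hNA hV hVmeas hC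
    (hgrowth.mono fun _ h => h.1) (hgrowth.mono fun _ h => h.2) hN hVN hM (hVpos M)
  refine ⟨fun x₀ x₁ => ?_, fun x => ?_, fun I hI =>
    (hdom le_rfl).exists_value_neg_le hH hY hγ₁ hγ hI⟩
  · obtain ⟨K, hK, hKpos, hvalue⟩ := (hdom (le_max_of_le_left (abs_nonneg x₀) :
      0 ≤ max |x₀| |x₁|)).exists_value_ae_eq_valueBounded hH hY hmono (hVneg _) hγ₁ hγ
    exact ⟨K, hK, hKpos, fun x hx => hvalue _ measurable_const
      (.of_forall fun _ => abs_le_max_abs_abs hx.1 hx.2)⟩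
  · exact (bot_lt_value hmono (hVneg (-|x|)) (.of_forall fun _ => neg_abs_le x)).and
      ((hdom (abs_nonneg x)).value_lt_top hH hY hmono (hVneg _) hγ₁ hγ measurable_const
        (.of_forall fun _ => le_rfl))

theorem lemma3p1 {Ω : Type*}
    -- the σ-algebras `ℋ ⊆ ℱ ⊆ m0`, containing the `P`-null sets
    (ℋ ℱ : MeasurableSpace Ω) [m0 : MeasurableSpace Ω] (P : Measure Ω) [IsProbabilityMeasure P]
    (hHF : ℋ ≤ ℱ) (hF : ℱ ≤ m0)
    (hnull : ∀ s : Set Ω, MeasurableSet[m0] s → P s = 0 → MeasurableSet[ℋ] s)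
    {d : ℕ} (Y : Ω → EuclideanSpace ℝ (Fin d)) (hY : Measurable[ℱ] Y)
    (D : Ω → Set (EuclideanSpace ℝ (Fin d))) (hD : OneStep.IsSupportSubspace ℋ P Y D)
    -- quantitative absence of arbitrage
    (α β : Ω → ℝ) (hα : Measurable[ℋ] α) (hβ : Measurable[ℋ] β)
    (hαpos : ∀ᵐ ω ∂P, 0 < α ω) (hβpos : ∀ᵐ ω ∂P, 0 < β ω)
    (hNA : ∀ ξ : Ω → EuclideanSpace ℝ (Fin d), Measurable[ℋ] ξ → (∀ᵐ ω ∂P, ξ ω ∈ D ω) →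
      ∀ᵐ ω ∂P, β ω ≤
        (P[{ω' | inner ℝ (ξ ω') (Y ω') ≤ -α ω' * ‖ξ ω'‖}.indicator (fun _ => (1 : ℝ)) | ℋ]) ω)
    -- the random function `V`
    (V : Ω → ℝ → ℝ) (hV : ∀ᵐ ω ∂P, Monotone (V ω) ∧ Continuous (V ω))
    (hVmeas : ∀ x : ℝ, Measurable[ℱ] (fun ω => V ω x))
    -- conditional integrability of `V⁻(x - |y||Y|)` and `V⁺(x + |y||Y|)`
    (hVneg : ∀ x y : ℝ, ∀ᵐ ω ∂P,
      condLExp ℋ P (fun ω' => ENNReal.ofReal (-V ω' (x - |y| * ‖Y ω'‖))) ω < ⊤)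
    (hVpos : ∀ x y : ℝ, ∀ᵐ ω ∂P,
      condLExp ℋ P (fun ω' => ENNReal.ofReal (V ω' (x + |y| * ‖Y ω'‖))) ω < ⊤)
    -- growth conditions; `γ₁` and `γ₂` are the upper and the lower exponent
    (C γ₁ γ₂ : ℝ) (hC : 0 < C) (hγ₁ : 0 < γ₁) (hγ : γ₁ < γ₂)
    (hgrowth : ∀ᵐ ω ∂P, ∀ x l : ℝ, 1 ≤ l →
      V ω (l * x) ≤ l ^ γ₁ * V ω x + C * l ^ γ₁ ∧
      V ω (l * x) ≤ l ^ γ₂ * V ω x + C * l ^ γ₂)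
    (N : Ω → ℝ) (hN : Measurable[ℋ] N) (hNnonneg : ∀ᵐ ω ∂P, 0 ≤ N ω)
    (hVN : ∀ᵐ ω ∂P, 1 - β ω / 2 ≤
      (P[{ω' | V ω' (-N ω') < -(2 * C / β ω') - 1}.indicator (fun _ => (1 : ℝ)) | ℋ]) ω) :
    -- strategies may be taken bounded by a variable `K` that works on all of `[x₀, x₁]`
    (∀ x₀ x₁ : ℝ, x₀ < x₁ → ∃ K : Ω → ℝ, Measurable[ℋ] K ∧ (∀ ω, 0 < K ω) ∧
      ∀ x ∈ Set.Icc x₀ x₁,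
        OneStep.value ℋ P V Y (fun _ => x) =ᵐ[P] OneStep.valueBounded ℋ P V Y K (fun _ => x)) ∧
    -- `v` is finite
    (∀ x : ℝ, ∀ᵐ ω ∂P, ⊥ < OneStep.value ℋ P V Y (fun _ => x) ω ∧
      OneStep.value ℋ P V Y (fun _ => x) ω < ⊤) ∧
    -- `v(-N') ≤ -I`, for the value at the random capital `-N'`, and also for the evaluation at
    -- `-N'` of any version `w` of the random field `v` with nondecreasing paths
    (∀ I : Ω → ℝ, Measurable[ℋ] I → (∀ᵐ ω ∂P, 0 < I ω) →
      ∃ N' : Ω → ℝ, Measurable[ℋ] N' ∧ (∀ ω, 0 < N' ω) ∧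
        (∀ᵐ ω ∂P, OneStep.value ℋ P V Y (fun ω' => -N' ω') ω ≤ ((-I ω : ℝ) : EReal)) ∧
        ∀ w : Ω → ℝ → EReal,
          (∀ x : ℝ, (fun ω => w ω x) =ᵐ[P] OneStep.value ℋ P V Y (fun _ => x)) →
          (∀ᵐ ω ∂P, Monotone (w ω)) →
          ∀ᵐ ω ∂P, w ω (-N' ω) ≤ ((-I ω : ℝ) : EReal)) := by
  have hNA' (ξ : Ω → EuclideanSpace ℝ (Fin d)) (hξ : Measurable[ℋ] ξ)
      (hspan : ∀ ω, ξ ω ∈ Submodule.span ℝ (OneStep.regCondDistrib ℋ P Y ω).support) :=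
    hNA ξ hξ (hD.span_support_subset.mono fun ω hω => hω (hspan ω))
  obtain ⟨hbounded, hfinite, hdebt⟩ := lemma3p1_general ℋ P (hHF.trans hF) Y
    (hY.mono hF le_rfl) α β hα hβ hαpos hβpos hNA' V hV (fun x => (hVmeas x).mono hF le_rfl)
    (by simpa using fun x => hVneg x 0) (by simpa using fun x => hVpos x 1) C γ₁ γ₂ hC.le hγ₁.le hγ
    (hgrowth.mono fun ω h => ⟨fun x l hl => (h x l hl).1, fun x l hl => (h x l hl).2⟩) N hN hVN
  exact ⟨fun x₀ x₁ _ => hbounded x₀ x₁, hfinite, fun I hI _ => hdebt I hI⟩
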